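/- Every context-sensitive language is accepted by a nondeterministic iterated uniform finite-state transducer which moreover rejects every word outside the language. Precisely: a language $L\subseteq\Sigma^*$ over a finite alphabet $\Sigma$ is context-sensitive if it is generated by a grammar with finitely many nonterminals and finitely many rules of the form $\alpha A\beta\to\alpha\gamma\beta$, where $A$ is a nonterminal, $\alpha,\beta,\gamma$ are words over terminals and nonterminals and $\gamma\neq\varepsilon$; in addition the rule $S\to\varepsilon$ for the start symbol $S$ is allowed if $S$ occurs on the right-hand side of no rule. A nondeterministic iterated uniform finite-state transducer is a system $M=\langle Q,\Sigma,\Delta,q_0,\triangleleft,\delta,F_+,F_-\rangle$ with finite sets $Q$ (states), $\Sigma$ (input symbols), $\Delta$ (output symbols), an initial state $q_0\in Q$, an endmarker $\triangleleft\in\Delta\setminus\Sigma$, accepting states $F_+\subseteq Q$, rejecting states $F_-\subseteq Q\setminus F_+$, and a partial transition function $\delta$ that assigns to pairs in $Q\times(\Sigma\cup\Delta)$ nonempty subsets of $Q\times\Delta$, is defined at every $(q,a)$ with $q\notin F_+\cup F_-$, and outputs $\triangleleft$ only when $\triangleleft$ is read. In a sweep over a word, $M$ starts in $q_0$, reads the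 word from left to right and, for each symbol $a$ read in state $q$, chooses $(p,b)\in\delta(q,a)$, writes $b$ and moves to state $p$; thus the output has the same length as the word read. A computation on $w\in\Sigma^*$ consists of successive sweeps, the first over $w\triangleleft$ and each later one over the output of the previous one. It halts when, during a sweep, $\delta$ is undefined at the current state and next symbol, or when a sweep ends in a state of $F_+\cup F_-$. The word $w$ is accepted if all computations on $w$ halt and at least one halts in a state of $F_+$; it is rejected if all computations on $w$ halt and none halts in a state of $F_+$. Theorem. For every finite alphabet $\Sigma$ and every context-sensitive language $L\subseteq\Sigma^*$ there is a nondeterministic iterated uniform finite-state transducer $M$ with input alphabet $\Sigma$ such that the set of words accepted by $M$ is exactly $L$, and every $w\in\Sigma^*\setminus L$ is rejected by $M$ (so all computations of $M$ halt, on every input). -/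

import Mathlib

universe u

/-- A context-sensitive rule `α A β → α γ β`: the nonterminal `A` is rewritten to `γ` in the
context `α _ β`, where `α`, `β`, `γ` are strings of terminals and nonterminals. -/
structure ContextSensitiveRule (T N : Type*) where
  /-- Left context `α`. -/
  left : List (Symbol T N)
  /-- The rewritten nonterminal `A`. -/
  input : N
  /-- Right context `β`. -/
  right : List (Symbol T N)
  /-- The replacement `γ`. -/
  output : List (Symbol T N)

/-- One application of the rule somewhere inside the string `u`, with result `v`. -/
def ContextSensitiveRule.Rewrites {T N : Type*} (r : ContextSensitiveRule T N)
    (u v : List (Symbol T N)) : Prop :=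
  ∃ p q : List (Symbol T N),
    u = p ++ r.left ++ [Symbol.nonterminal r.input] ++ r.right ++ q ∧
    v = p ++ r.left ++ r.output ++ r.right ++ q

/-- A context-sensitive grammar with terminal alphabet `T`. -/
structure ContextSensitiveGrammar (T : Type*) where
  /-- Nonterminals. -/
  NT : Type
  finite_NT : Finite NT
  /-- Start symbol. -/
  initial : NT
  /-- Rules. -/
  rules : Finset (ContextSensitiveRule T NT)
  /-- No rule erases its nonterminal, except that `S → ε` is allowed for the start symbol `S` when
  `S` occurs on the right-hand side of no rule. -/
  nonerasing : ∀ r ∈ rules, r.output ≠ [] ∨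
    (r = ⟨[], initial, [], []⟩ ∧
      ∀ r' ∈ rules, Symbol.nonterminal initial ∉ r'.left ++ r'.output ++ r'.right)

namespace ContextSensitiveGrammar

/-- One derivation step. -/
def Produces {T : Type*} (G : ContextSensitiveGrammar T) (u v : List (Symbol T G.NT)) : Prop :=
  ∃ r ∈ G.rules, r.Rewrites u v

/-- Derivation in any number of steps. -/
def Derives {T : Type*} (G : ContextSensitiveGrammar T) :
    List (Symbol T G.NT) → List (Symbol T G.NT) → Prop :=
  Relation.ReflTransGen G.Produces

/-- The language generated by the grammar. -/
def language {T : Type*} (G : ContextSensitiveGrammar T) : Language T :=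
  {w | G.Derives [Symbol.nonterminal G.initial] (w.map Symbol.terminal)}

end ContextSensitiveGrammar

/-- A language is context-sensitive if some context-sensitive grammar generates it. -/
def Language.IsContextSensitive {T : Type*} (L : Language T) : Prop :=
  ∃ G : ContextSensitiveGrammar T, G.language = L

/-- A nondeterministic iterated uniform finite-state transducer
`⟨Q, Σ, Δ, q₀, ◁, δ, F₊, F₋⟩`, with input alphabet `Σ = T`. The type `Sym` is the union `Σ ∪ Δ`
(in which `Σ` and `Δ` may overlap). The transition function is partial; `δ q a = ∅` encodes that
it is undefined at `(q, a)`. -/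
structure IteratedUniformTransducer (T : Type u) where
  /-- States `Q`. -/
  State : Type u
  /-- All symbols, `Σ ∪ Δ`. -/
  Sym : Type u
  finite_State : Finite State
  finite_Sym : Finite Sym
  /-- The input symbols `Σ` among all symbols. -/
  inp : T ↪ Sym
  /-- Output symbols `Δ`. -/
  Δ : Set Sym
  sym_mem : ∀ a : Sym, a ∈ Set.range inp ∨ a ∈ Δ
  /-- Initial state. -/
  q₀ : State
  /-- The endmarker `◁ ∈ Δ \ Σ`. -/
  endmarker : Sym
  endmarker_mem : endmarker ∈ Δ
  endmarker_notMem : endmarker ∉ Set.range inp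
  /-- Accepting states `F₊`. -/
  acc : Set State
  /-- Rejecting states `F₋ ⊆ Q \ F₊`. -/
  rej : Set State
  disjoint_acc_rej : Disjoint acc rej
  /-- Transition function: from state `q` reading `a`, each `(p, b) ∈ δ q a` is a possible move to
  state `p` writing `b`. -/
  δ : State → Sym → Set (State × Sym)
  /-- Only output symbols are written. -/
  out_mem : ∀ q a p b, (p, b) ∈ δ q a → b ∈ Δ
  /-- The transition function is total outside the accepting and rejecting states. -/
  δ_total : ∀ q a, q ∉ acc ∪ rej → (δ q a).Nonempty
  /-- The endmarker is output only if it is read. -/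
  endmarker_out : ∀ q a p, (p, endmarker) ∈ δ q a → a = endmarker

namespace IteratedUniformTransducer

/-- `M.Run q u p v`: started in state `q`, `M` can read the whole word `u`, write `v`, and end in
state `p`. -/
inductive Run {T : Type u} (M : IteratedUniformTransducer T) :
    M.State → List M.Sym → M.State → List M.Sym → Prop
  | nil (q : M.State) : Run M q [] q []
  | cons {q q' p : M.State} {a b : M.Sym} {u v : List M.Sym} :
      (q', b) ∈ M.δ q a → Run M q' u p v → Run M q (a :: u) p (b :: v)

/-- `M` can halt in state `q` during a sweep over `u`: either the sweep is completed in an accepting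
or rejecting state `q`, or within the sweep the transition function is undefined at the current
state `q` and the next symbol. -/
def HaltsIn {T : Type u} (M : IteratedUniformTransducer T) (u : List M.Sym) (q : M.State) : Prop :=
  (∃ v, M.Run M.q₀ u q v ∧ q ∈ M.acc ∪ M.rej) ∨
  (∃ u₁ a u₂ v, u = u₁ ++ a :: u₂ ∧ M.Run M.q₀ u₁ q v ∧ M.δ q a = ∅)

/-- One sweep that does not halt: `M` reads `u` completely, writes `v`, and ends in a state that is
neither accepting nor rejecting, so that the next sweep is over `v`. -/
def Sweep {T : Type u} (M : IteratedUniformTransducer T) (u v : List M.Sym) : Prop :=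
  ∃ q, M.Run M.q₀ u q v ∧ q ∉ M.acc ∪ M.rej

/-- The word `w◁` over which the first sweep runs. -/
def start {T : Type u} (M : IteratedUniformTransducer T) (w : List T) : List M.Sym :=
  w.map M.inp ++ [M.endmarker]

/-- All computations on input `w` halt: there is no infinite sequence of sweeps. -/
def AllHalt {T : Type u} (M : IteratedUniformTransducer T) (w : List T) : Prop :=
  ¬ ∃ f : ℕ → List M.Sym, f 0 = M.start w ∧ ∀ n, M.Sweep (f n) (f (n + 1))

/-- Some computation on input `w` halts in an accepting state. -/
def SomeAccepting {T : Type u} (M : IteratedUniformTransducer T) (w : List T) : Prop :=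
  ∃ u q, Relation.ReflTransGen M.Sweep (M.start w) u ∧ M.HaltsIn u q ∧ q ∈ M.acc

/-- `w` is accepted: all computations halt, and at least one of them in an accepting state. -/
def Accepts {T : Type u} (M : IteratedUniformTransducer T) (w : List T) : Prop :=
  M.AllHalt w ∧ M.SomeAccepting w

/-- `w` is rejected: all computations halt, and none of them in an accepting state. -/
def Rejects {T : Type u} (M : IteratedUniformTransducer T) (w : List T) : Prop :=
  M.AllHalt w ∧ ¬ M.SomeAccepting w

/-- The language accepted by `M`. -/
def language {T : Type u} (M : IteratedUniformTransducer T) : Language T :=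
  {w | M.Accepts w}

end IteratedUniformTransducer

/-! The transducer searches for a derivation backwards. Its tape holds a string padded with blanks,
of fixed length. A rule `αAβ → αγβ` with `γ ≠ ε` is undone in place: the first symbol of `γ` becomes
`A` and the others become blanks. One left-to-right pass suffices: the device guesses rule and
position and remembers the part of `αγβ` still to be matched (`PatternRun`). The erasing rule is
never needed for a nonempty word (`Derives.nonerasing`). At the endmarker, a string of at most one
symbol is accepted iff it is derivable; this is a finite table built into the transitions, and it
covers both the start symbol and the empty word.

To force halting, each cell also carries a digit. Every sweep enters with carry 1 and so increments
the little-endian counter; overflow forbids a further sweep, so there are fewer than `base ^ |w|`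
continuing sweeps (`transducer_allHalt`). This bound loses no word: a path of reductions without
repetition is shorter than the number of padded strings of length `|w|`, which is at most `base ^
|w|` (`exists_patternRuns`). Soundness holds for all guesses, as each continuing sweep undoes one
rule or none (`sweep_cells`). -/

/-- A relation path in a finite type can be shortened below the cardinality of the type. -/
theorem Relation.ReflTransGen.exists_short_path {X : Type*} [Finite X] {r : X → X → Prop} {a b : X}
    (h : Relation.ReflTransGen r a b) :
    ∃ m < Nat.card X, ∃ f : ℕ → X, f 0 = a ∧ f m = b ∧ ∀ i < m, r (f i) (f (i + 1)) := by
  classical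
  have hex : ∃ m, ∃ f : ℕ → X, f 0 = a ∧ f m = b ∧ ∀ i < m, r (f i) (f (i + 1)) := by
    induction h with
    | refl => exact ⟨0, fun _ => a, rfl, rfl, by simp⟩
    | @tail b c _ hbc ih =>
      obtain ⟨m, f, h0, hm, hf⟩ := ih
      refine ⟨m + 1, fun i => if i ≤ m then f i else c, by simpa using h0, by simp, ?_⟩
      intro i hi
      rcases Nat.lt_succ_iff_lt_or_eq.mp hi with h | rfl
      · simpa [h.le, Nat.succ_le_of_lt h] using hf i h
      · simpa [hm] using hbc
  obtain ⟨f, h0, hm, hf⟩ := Nat.find_spec hex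
  refine ⟨Nat.find hex, ?_, f, h0, hm, hf⟩
  set m := Nat.find hex with hmdef
  -- In a path of minimal length `m` the vertices are distinct: a repetition `f i = f j` could be
  -- cut out, saving `j - i` steps.
  have key : ∀ i j, i < j → j ≤ m → f i ≠ f j := by
    intro i j hij hj hfe
    have hlt : m - (j - i) < Nat.find hex := by omega
    refine Nat.find_min hex hlt ⟨fun k => if k ≤ i then f k else f (k + (j - i)), by simpa using h0,
      ?_, ?_⟩
    · by_cases hc : m - (j - i) ≤ i
      · have h1 : m = j := by omega
        have h2 : m - (j - i) = i := by omega
        simp only [h2, le_refl, if_true]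
        rw [hfe, ← h1, hm]
      · have h2 : m - (j - i) + (j - i) = m := by omega
        simp only [hc, if_false, h2, hm]
    · intro k hk
      rcases lt_trichotomy k i with h | rfl | h
      · simpa [h.le, Nat.succ_le_of_lt h] using hf k (by omega)
      · have h2 : k + 1 + (j - k) = j + 1 := by omega
        simp only [le_refl, if_true, h2, hfe]
        simpa using hf j (by omega)
      · have h1 : ¬ k ≤ i := by omega
        have h2 : ¬ k + 1 ≤ i := by omega
        have h3 : k + 1 + (j - i) = k + (j - i) + 1 := by omega
        simpa only [h1, h2, if_false, h3] using hf (k + (j - i)) (by omega)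
  have hinj : Function.Injective (fun i : Fin (m + 1) => f i) := by
    intro i j hij
    by_contra hne
    rcases lt_or_gt_of_ne hne with h | h
    · exact key i j h (by omega) hij
    · exact key j i h (by omega) hij.symm
  have := Nat.card_le_card_of_injective _ hinj
  simp only [Nat.card_eq_fintype_card, Fintype.card_fin] at this
  simpa using this

/-- Little-endian value of a string of base-`b` digits. -/
def digitValue {b : ℕ} : List (Fin b) → ℕ
  | [] => 0
  | d :: l => d + b * digitValue l

theorem digitValue_lt {b : ℕ} (l : List (Fin b)) : digitValue l < b ^ l.length := by
  induction l with
  | nil => simp [digitValue]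
  | cons d l ih =>
    have h1 : b * (digitValue l + 1) ≤ b * b ^ l.length := Nat.mul_le_mul_left b ih
    have h2 := d.isLt
    simp only [digitValue, List.length_cons, pow_succ']
    rw [Nat.mul_add] at h1
    omega

/-! ### Rewriting padded strings in one pass -/

section Pattern

variable {S : Type*}

/-- One move of a one-pass rewriting device on a padded string (`none` is a blank). A phase
`some P` means that the pairs of `P` are still to be read and replaced; the phase `none` means that
no pattern has been started yet. -/
inductive PatternStep (pats : Set (List (S × Option S))) :
    Option (List (S × Option S)) → Option S → Option (List (S × Option S)) → Option S → Prop
  | wait (x : Option S) : PatternStep pats none x none x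
  | start {P : List (S × Option S)} {x y : Option S} {p : Option (List (S × Option S))} :
      P ∈ pats → PatternStep pats (some P) x p y → PatternStep pats none x p y
  | blank (P : List (S × Option S)) : PatternStep pats (some P) none (some P) none
  | replace (a : S) (b : Option S) (P : List (S × Option S)) :
      PatternStep pats (some ((a, b) :: P)) (some a) (some P) b
  | copy (a : S) : PatternStep pats (some []) (some a) (some []) (some a)

/-- Iteration of `PatternStep` over a padded string. -/
inductive PatternRun (pats : Set (List (S × Option S))) :
    Option (List (S × Option S)) → List (Option S) →
      Option (List (S × Option S)) → List (Option S) → Prop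
  | nil (p : Option (List (S × Option S))) : PatternRun pats p [] p []
  | cons {p p' p'' : Option (List (S × Option S))} {x y : Option S} {u v : List (Option S)} :
      PatternStep pats p x p' y → PatternRun pats p' u p'' v →
        PatternRun pats p (x :: u) p'' (y :: v)

variable {pats : Set (List (S × Option S))}

theorem PatternRun.length_eq {p p' : Option (List (S × Option S))} {u v : List (Option S)}
    (h : PatternRun pats p u p' v) : v.length = u.length := by
  induction h with
  | nil => rfl
  | cons _ _ ih => simp [ih]

theorem PatternStep.isSome {P : List (S × Option S)} {p : Option (List (S × Option S))}
    {x y : Option S} (h : PatternStep pats (some P) x p y) : p.isSome := by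
  cases h <;> rfl

theorem PatternRun.isSome {p p' : Option (List (S × Option S))} {u v : List (Option S)}
    (h : PatternRun pats p u p' v) (hp : p.isSome) : p'.isSome := by
  induction h with
  | nil => exact hp
  | cons hs _ ih =>
    obtain ⟨P, rfl⟩ := Option.isSome_iff_exists.mp hp
    exact ih hs.isSome

/-- The phase records exactly the unread part of the pattern, so ending in `some []` means all of it
was matched, up to blanks, at the front. -/
theorem PatternRun.sound_some {p p' : Option (List (S × Option S))} {u v : List (Option S)}
    (h : PatternRun pats p u p' v) {P : List (S × Option S)} (hp : p = some P)
    (hp' : p' = some []) :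
    ∃ q, u.reduceOption = P.map Prod.fst ++ q ∧
      v.reduceOption = (P.map Prod.snd).reduceOption ++ q := by
  induction h generalizing P with
  | nil p =>
    obtain rfl : P = [] := by simpa [hp] using hp'
    exact ⟨[], by simp, by simp⟩
  | @cons _ _ _ x b _ _ hs _ ih =>
    subst hp
    cases hs with
    | blank => simpa using ih rfl hp'
    | replace a _ P =>
      obtain ⟨q, h1, h2⟩ := ih rfl hp'
      refine ⟨q, by simp [h1], ?_⟩
      cases b <;> simp [h2]
    | copy a =>
      obtain ⟨q, h1, h2⟩ := ih rfl hp'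
      exact ⟨a :: q, by simp_all, by simp_all⟩

/-- A started pattern never returns to the phase `none`, so only waiting moves occur. -/
theorem PatternRun.sound_none {p p' : Option (List (S × Option S))} {u v : List (Option S)}
    (h : PatternRun pats p u p' v) (hp : p = none) (hp' : p' = none) : v = u := by
  induction h with
  | nil => rfl
  | cons hs hr ih =>
    subst hp
    cases hs with
    | wait => rw [ih rfl hp']
    | start hP hs =>
      have := hr.isSome hs.isSome
      simp [hp'] at this

theorem PatternRun.sound {p p' : Option (List (S × Option S))} {u v : List (Option S)}
    (h : PatternRun pats p u p' v) (hp : p = none) (hp' : p' = some []) :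
    ∃ P ∈ pats, ∃ p q, u.reduceOption = p ++ P.map Prod.fst ++ q ∧
      v.reduceOption = p ++ (P.map Prod.snd).reduceOption ++ q := by
  induction h with
  | nil => simp [hp] at hp'
  | @cons _ _ _ x _ _ _ hs hr ih =>
    subst hp
    cases hs with
    | wait =>
      obtain ⟨P, hP, p, q, h1, h2⟩ := ih rfl hp'
      cases x with
      | none => exact ⟨P, hP, p, q, by simpa using h1, by simpa using h2⟩
      | some a => exact ⟨P, hP, a :: p, q, by simpa using h1, by simpa using h2⟩
    | @start P _ _ _ hP hs =>
      obtain ⟨q, h1, h2⟩ := (PatternRun.cons hs hr).sound_some rfl hp'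
      exact ⟨P, hP, [], q, by simpa using h1, by simpa using h2⟩

theorem PatternRun.exists_of_some {P : List (S × Option S)} {q : List S} {u : List (Option S)}
    (h : u.reduceOption = P.map Prod.fst ++ q) :
    ∃ v, PatternRun pats (some P) u (some []) v ∧
      v.reduceOption = (P.map Prod.snd).reduceOption ++ q := by
  induction u generalizing P q with
  | nil =>
    obtain ⟨rfl, rfl⟩ : P = [] ∧ q = [] := by simpa using h
    exact ⟨[], .nil _, by simp⟩
  | cons x u ih =>
    cases x with
    | none =>
      obtain ⟨v, hv, hq⟩ := ih (by simpa using h)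
      exact ⟨none :: v, .cons (.blank P) hv, by simpa using hq⟩
    | some a =>
      cases P with
      | nil =>
        cases q with
        | nil => simp at h
        | cons c q =>
          simp only [List.reduceOption_cons_of_some, List.map_nil, List.nil_append,
            List.cons.injEq] at h
          obtain ⟨rfl, h⟩ := h
          obtain ⟨v, hv, hq⟩ := ih (P := []) (by simpa using h)
          exact ⟨some a :: v, .cons (.copy a) hv, by simpa using hq⟩
      | cons ab P =>
        obtain ⟨c, b⟩ := ab
        simp only [List.reduceOption_cons_of_some, List.map_cons, List.cons_append,
            List.cons.injEq] at h
        obtain ⟨rfl, h⟩ := h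
        obtain ⟨v, hv, hq⟩ := ih h
        refine ⟨b :: v, .cons (.replace a b P) hv, ?_⟩
        cases b <;> simp [hq]

/-- Wait through `p`, then match. Nonemptiness of `P` is needed because a pattern can only be
started while some symbol is read. -/
theorem PatternRun.exists_of_none {P : List (S × Option S)} (hP : P ∈ pats) (hne : P ≠ [])
    {p q : List S} {u : List (Option S)} (h : u.reduceOption = p ++ P.map Prod.fst ++ q) :
    ∃ v, PatternRun pats none u (some []) v ∧
      v.reduceOption = p ++ (P.map Prod.snd).reduceOption ++ q := by
  induction u generalizing p with
  | nil => simp [hne] at h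
  | cons x u ih =>
    cases p with
    | nil =>
      obtain ⟨v, hv, hq⟩ := PatternRun.exists_of_some (pats := pats) (P := P) (q := q)
        (by simpa using h)
      -- Starting a pattern reads no symbol of its own, so it is merged with the first move of the
      -- matching run, even if that move reads a blank.
      cases hv with
      | cons hs hr => exact ⟨_, .cons (.start hP hs) hr, by simpa using hq⟩
    | cons c p =>
      cases x with
      | none =>
        obtain ⟨v, hv, hq⟩ := ih (p := c :: p) (by simpa using h)
        exact ⟨none :: v, .cons (.wait _) hv, by simpa using hq⟩
      | some a =>
        simp only [List.reduceOption_cons_of_some, List.cons_append, List.cons.injEq] at h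
        obtain ⟨rfl, h⟩ := h
        obtain ⟨v, hv, hq⟩ := ih h
        exact ⟨some a :: v, .cons (.wait _) hv, by simpa using hq⟩

end Pattern

/-! ### Reductions of context-sensitive grammars on padded strings -/

/-- Replace the first symbol of a string by `a` and the other ones by blanks. -/
def shrinkPattern {S : Type*} (a : S) : List S → List (S × Option S)
  | [] => []
  | c :: l => (c, some a) :: l.map fun s => (s, none)

theorem map_fst_shrinkPattern {S : Type*} (a : S) (l : List S) :
    (shrinkPattern a l).map Prod.fst = l := by
  cases l <;> simp [shrinkPattern, Function.comp_def]

theorem reduceOption_map_snd_shrinkPattern {S : Type*} (a : S) {l : List S} (hl : l ≠ []) :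
    ((shrinkPattern a l).map Prod.snd).reduceOption = [a] := by
  cases l with
  | nil => exact absurd rfl hl
  | cons c l =>
    simp only [shrinkPattern, List.map_cons, List.map_map, List.reduceOption_cons_of_some]
    simp [Function.comp_def]

namespace ContextSensitiveRule

variable {T N : Type*}

/-- The pattern by which a one-pass device undoes an application of the rule. -/
def pattern (r : ContextSensitiveRule T N) : List (Symbol T N × Option (Symbol T N)) :=
  r.left.map (fun s => (s, some s)) ++ shrinkPattern (.nonterminal r.input) r.output ++
    r.right.map fun s => (s, some s)

theorem map_fst_pattern (r : ContextSensitiveRule T N) :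
    r.pattern.map Prod.fst = r.left ++ r.output ++ r.right := by
  simp [pattern, map_fst_shrinkPattern, Function.comp_def]

theorem reduceOption_map_snd_pattern (r : ContextSensitiveRule T N) (hr : r.output ≠ []) :
    (r.pattern.map Prod.snd).reduceOption =
      r.left ++ [Symbol.nonterminal r.input] ++ r.right := by
  have h : ∀ l : List (Symbol T N), (l.map some).reduceOption = l := fun l => by
    induction l <;> simp_all
  simp [pattern, List.reduceOption_append, reduceOption_map_snd_shrinkPattern _ hr,
    Function.comp_def, h]

theorem pattern_ne_nil (r : ContextSensitiveRule T N) (hr : r.output ≠ []) : r.pattern ≠ [] := by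
  intro h
  have := r.map_fst_pattern
  simp [h, hr] at this

end ContextSensitiveRule

namespace ContextSensitiveGrammar

variable {T : Type*} (G : ContextSensitiveGrammar T)

/-- One derivation step with a nonerasing rule. -/
def ProducesNonerasing (u v : List (Symbol T G.NT)) : Prop :=
  ∃ r ∈ G.rules, r.output ≠ [] ∧ r.Rewrites u v

/-- The patterns that undo nonerasing rules. -/
def patterns : Set (List (Symbol T G.NT × Option (Symbol T G.NT))) :=
  {P | ∃ r ∈ G.rules, r.output ≠ [] ∧ P = r.pattern}

/-- The unfinished parts of the patterns that undo rules. -/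
def phases : Set (List (Symbol T G.NT × Option (Symbol T G.NT))) :=
  {P | ∃ r ∈ G.rules, P <:+ r.pattern}

theorem finite_phases : G.phases.Finite := by
  have : G.phases = ⋃ r ∈ (G.rules : Set (ContextSensitiveRule T G.NT)),
      {P | P <:+ r.pattern} := by
    ext P; simp [phases]
  rw [this]
  refine G.rules.finite_toSet.biUnion fun r _ => ?_
  refine (List.finite_toSet r.pattern.tails).subset fun P hP => ?_
  simpa using hP

/-- Moves only shorten a pattern to a suffix; hence finitely many phases serve as control states. -/
theorem mem_phases_of_step {p p' : Option (List (Symbol T G.NT × Option (Symbol T G.NT)))}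
    {x y : Option (Symbol T G.NT)} (h : PatternStep G.patterns p x p' y)
    (hp : ∀ P ∈ p, P ∈ G.phases) : ∀ P ∈ p', P ∈ G.phases := by
  induction h with
  | wait => exact hp
  | start hP _ ih =>
    apply ih
    rintro P' hP'
    obtain rfl : _ = P' := by simpa using hP'
    obtain ⟨r, hr, _, rfl⟩ := hP
    exact ⟨r, hr, List.suffix_rfl⟩
  | blank => exact hp
  | replace a b P =>
    intro P' hP'
    obtain rfl : _ = P' := by simpa using hP'
    obtain ⟨r, hr, hs⟩ := hp _ rfl
    exact ⟨r, hr, (List.suffix_cons _ _).trans hs⟩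
  | copy => exact hp

variable {G}

theorem ProducesNonerasing.produces {u v : List (Symbol T G.NT)} (h : G.ProducesNonerasing u v) :
    G.Produces u v :=
  let ⟨r, hr, _, h⟩ := h
  ⟨r, hr, h⟩

theorem producesNonerasing_of_patternRun {x y : List (Option (Symbol T G.NT))}
    (h : PatternRun G.patterns none x (some []) y) :
    G.ProducesNonerasing y.reduceOption x.reduceOption := by
  obtain ⟨_, ⟨r, hr, hne, rfl⟩, p, q, h1, h2⟩ := h.sound rfl rfl
  rw [r.map_fst_pattern] at h1
  rw [r.reduceOption_map_snd_pattern hne] at h2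
  exact ⟨r, hr, hne, p, q, by simp [h2], by simp [h1]⟩

theorem ProducesNonerasing.exists_patternRun {u : List (Symbol T G.NT)}
    {x : List (Option (Symbol T G.NT))} (h : G.ProducesNonerasing u x.reduceOption) :
    ∃ y, PatternRun G.patterns none x (some []) y ∧ y.reduceOption = u := by
  obtain ⟨r, hr, hne, p, q, hu, hx⟩ := h
  obtain ⟨y, hy, h2⟩ := PatternRun.exists_of_none (pats := G.patterns) ⟨r, hr, hne, rfl⟩
    (r.pattern_ne_nil hne) (p := p) (q := q) (u := x)
    (by rw [r.map_fst_pattern, hx]; simp)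
  rw [r.reduceOption_map_snd_pattern hne] at h2
  exact ⟨y, hy, by rw [h2, hu]; simp⟩

theorem Produces.left_ne_nil {u v : List (Symbol T G.NT)} (h : G.Produces u v) : u ≠ [] := by
  obtain ⟨r, _, p, q, rfl, _⟩ := h
  simp

/-- No right-hand side contains the start symbol, so after the first step it is gone for good. -/
theorem Derives.eq_or_initial_notMem
    (hG : ∀ r ∈ G.rules, Symbol.nonterminal G.initial ∉ r.left ++ r.output ++ r.right)
    {u : List (Symbol T G.NT)} (h : G.Derives [.nonterminal G.initial] u) :
    u = [.nonterminal G.initial] ∨ .nonterminal G.initial ∉ u := by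
  induction h with
  | refl => exact .inl rfl
  | tail _ hs ih =>
    right
    obtain ⟨r, hr, p, q, rfl, rfl⟩ := hs
    have := hG r hr
    rcases ih with ih | ih
    · have hl := congrArg List.length ih
      simp only [List.length_append, List.length_cons, List.length_nil] at hl
      -- The rewritten nonterminal already accounts for the whole length 1, so nothing surrounds the
      -- rule.
      obtain rfl : p = [] := List.length_eq_zero_iff.mp (by omega)
      obtain rfl : q = [] := List.length_eq_zero_iff.mp (by omega)
      simpa using this
    · simp only [List.mem_append, not_or] at this ih ⊢
      tauto

/-- The erasing rule could only act on the start symbol standing alone, producing the empty string.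
That is not `v`, and no rule applies to an empty string, so it is no intermediate string either. -/
theorem Derives.nonerasing {v : List (Symbol T G.NT)}
    (h : G.Derives [.nonterminal G.initial] v) (hv : v ≠ []) :
    Relation.ReflTransGen G.ProducesNonerasing [.nonterminal G.initial] v := by
  induction h with
  | refl => exact .refl
  | tail hd hs ih =>
    refine (ih hs.left_ne_nil).tail ?_
    obtain ⟨r, hr, hrw⟩ := hs
    refine ⟨r, hr, ?_, hrw⟩
    rcases G.nonerasing r hr with h | ⟨rfl, hG⟩
    · exact h
    · obtain ⟨p, q, rfl, rfl⟩ := hrw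
      rcases Derives.eq_or_initial_notMem hG hd with h | h
      · have hl := congrArg List.length h
        simp only [List.length_append, List.length_cons, List.length_nil] at hl
        obtain rfl : p = [] := List.length_eq_zero_iff.mp (by omega)
        obtain rfl : q = [] := List.length_eq_zero_iff.mp (by omega)
        simp at hv
      · simp at h

/-- A nonerasing derivation of a string is found by a sequence of one-pass reductions whose
number is less than the number of padded strings of the given length. -/
theorem exists_patternRuns [Finite T] {x : List (Option (Symbol T G.NT))}
    (h : G.Derives [.nonterminal G.initial] x.reduceOption) (hx : x.reduceOption ≠ []) :
    ∃ m < Nat.card (Option (Symbol T G.NT)) ^ x.length,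
      ∃ f : ℕ → List (Option (Symbol T G.NT)),
      f 0 = x ∧ (f m).reduceOption = [.nonterminal G.initial] ∧
        ∀ i < m, PatternRun G.patterns none (f i) (some []) (f (i + 1)) := by
  classical
  have := G.finite_NT
  have := Fintype.ofFinite T
  have := Fintype.ofFinite G.NT
  -- The claim is made for every padding `z` of `v`, since each undone rule yields a padding that
  -- cannot be prescribed. Vectors fix the length, which makes the space of paths finite.
  have key : ∀ v, Relation.ReflTransGen G.ProducesNonerasing [.nonterminal G.initial] v →
      ∀ z : List.Vector (Option (Symbol T G.NT)) x.length, z.1.reduceOption = v →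
      ∃ y : List.Vector (Option (Symbol T G.NT)) x.length,
        Relation.ReflTransGen (fun a b : List.Vector (Option (Symbol T G.NT)) x.length =>
          PatternRun G.patterns none a.1 (some []) b.1) z y ∧
        y.1.reduceOption = [.nonterminal G.initial] := by
    intro v hv
    induction hv with
    | refl => exact fun z hz => ⟨z, .refl, hz⟩
    | tail _ hs ih =>
      rintro z rfl
      obtain ⟨y, hy, hyu⟩ := hs.exists_patternRun
      obtain ⟨y', h1, h2⟩ := ih ⟨y, hy.length_eq.trans z.2⟩ hyu
      exact ⟨y', .head hy h1, h2⟩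
  obtain ⟨y, hy, hy'⟩ := key _ (h.nonerasing hx) ⟨x, rfl⟩ rfl
  obtain ⟨m, hm, f, h0, h1, h2⟩ := hy.exists_short_path
  refine ⟨m, by simpa using hm, fun i => (f i).1, by simp [h0], by simp [h1, hy'], h2⟩

end ContextSensitiveGrammar

/-! ### The transducer -/

/-- Truncating after every symbol loses nothing. Two remembered symbols tell whether the string has
at most one. -/
theorem take_two_append_take_two {α : Type*} (k l m : List α) :
    ((k ++ l).take 2 ++ m).take 2 = (k ++ (l ++ m)).take 2 := by
  rw [← List.append_assoc]
  generalize k ++ l = n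
  match n with
  | [] => rfl
  | [a] => rfl
  | a :: b :: n => simp

theorem exists_map_some_of_concat_eq {α : Type*} {l : List α} {u₁ u₂ : List (Option α)}
    {a : Option α} (h : l.map some ++ [none] = u₁ ++ a :: u₂) : ∃ w : List α, u₁ = w.map some := by
  have hpre : u₁ <+: l.map some := by
    refine List.prefix_of_prefix_length_le ⟨a :: u₂, h.symm⟩ (List.prefix_append _ [none]) ?_
    have := congrArg List.length h
    simp only [List.length_append, List.length_cons, List.length_nil] at this
    omega
  obtain ⟨t, ht⟩ := hpre
  obtain ⟨w₁, w₂, _, rfl, _⟩ := List.map_eq_append_iff.mp ht.symm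
  exact ⟨w₁, rfl⟩

theorem map_some_concat_injective {α : Type*} {l l' : List α}
    (h : l.map some ++ [none] = l'.map some ++ [none]) : l = l' :=
  List.map_injective_iff.mpr (Option.some_injective α) (List.append_cancel_right h)

namespace IteratedUniformTransducer

variable {T : Type u} {M : IteratedUniformTransducer T}

theorem Run.append {q r p : M.State} {u₁ v₁ u₂ v₂ : List M.Sym} (h₁ : M.Run q u₁ r v₁)
    (h₂ : M.Run r u₂ p v₂) : M.Run q (u₁ ++ u₂) p (v₁ ++ v₂) := by
  induction h₁ with
  | nil => exact h₂
  | cons h _ ih => exact .cons h (ih h₂)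

theorem Run.of_nil {q p : M.State} {v : List M.Sym} (h : M.Run q [] p v) : p = q ∧ v = [] := by
  cases h
  exact ⟨rfl, rfl⟩

theorem Run.exists_of_cons {q p : M.State} {a : M.Sym} {u v : List M.Sym}
    (h : M.Run q (a :: u) p v) :
    ∃ q' b v', (q', b) ∈ M.δ q a ∧ M.Run q' u p v' ∧ v = b :: v' := by
  cases h with
  | cons h h' => exact ⟨_, _, _, h, h', rfl⟩

theorem Run.exists_of_concat {q p : M.State} {u v : List M.Sym} {a : M.Sym}
    (h : M.Run q (u ++ [a]) p v) :
    ∃ r v' b, M.Run q u r v' ∧ (p, b) ∈ M.δ r a ∧ v = v' ++ [b] := by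
  induction u generalizing q v with
  | nil =>
    cases h with
    | @cons _ _ _ _ b _ _ h h' =>
      cases h'
      exact ⟨q, [], b, .nil q, h, rfl⟩
  | cons c u ih =>
    cases h with
    | cons h h' =>
      obtain ⟨r, v', b, h1, h2, rfl⟩ := ih h'
      exact ⟨r, _, b, .cons h h1, h2, rfl⟩

end IteratedUniformTransducer

namespace ContextSensitiveGrammar

section Transducer

variable {T : Type u} (G : ContextSensitiveGrammar T)

/-- Base of the counter on the tape. -/
noncomputable abbrev base : ℕ := Nat.card (Option (Symbol T G.NT)) + 1

/-- A tape cell: a symbol of a padded string, and a digit of a counter. -/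
abbrev Cell : Type u := Option (Symbol T G.NT) × Fin G.base

/-- The phases of the one-pass reductions. -/
abbrev Phase : Type u :=
  {p : Option (List (Symbol T G.NT × Option (Symbol T G.NT))) // ∀ P ∈ p, P ∈ G.phases}

/-- The first two symbols of the string read so far. -/
abbrev Seen : Type u := {l : List (Symbol T G.NT) // l.length ≤ 2}

/-- Working states: a phase of a reduction, a carry bit, and the first symbols read. -/
abbrev Work : Type u := G.Phase × Bool × G.Seen

/-- A move of the transducer on a tape cell. -/
def CellStep (s : G.Work) (a : G.Cell) (s' : G.Work) (b : G.Cell) : Prop :=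
  PatternStep G.patterns s.1.1 a.1 s'.1.1 b.1 ∧
  (b.2 : ℕ) + G.base * s'.2.1.toNat = a.2 + s.2.1.toNat ∧
  s'.2.2.1 = (s.2.2.1 ++ a.1.toList).take 2

/-- The initial state. -/
def initWork : G.Work := (⟨none, by simp⟩, true, ⟨[], by simp⟩)

/-- Acceptance at the endmarker: the string read is derivable and has at most one symbol. -/
def AcceptingWork (s : G.Work) : Prop :=
  s.2.2.1.length ≤ 1 ∧ G.Derives [.nonterminal G.initial] s.2.2.1

/-- Continuation at the endmarker: no reduction is unfinished and the counter has not
overflowed. -/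
def ContinuingWork (s : G.Work) : Prop :=
  (s.1.1 = none ∨ s.1.1 = some []) ∧ s.2.1 = false

/-- The transition relation; `Sum.inr true` is the accepting and `Sum.inr false` the rejecting
state, and `none` is the endmarker. -/
def move : G.Work ⊕ Bool → Option G.Cell → Set ((G.Work ⊕ Bool) × Option G.Cell)
  -- The unconditional rejecting move makes the transition function total on working states; it is
  -- harmless because one accepting computation suffices.
  | .inl s, some a => {t | t = (.inr false, some a) ∨
      ∃ s' b, G.CellStep s a s' b ∧ t = (.inl s', some b)}
  | .inl s, none => {t | t = (.inr false, none) ∨ (G.AcceptingWork s ∧ t = (.inr true, none)) ∨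
      (G.ContinuingWork s ∧ t = (.inl G.initWork, none))}
  | .inr _, _ => ∅

/-- The transducer that searches for a derivation backwards, one rule application per sweep, and
counts the sweeps on its tape. -/
noncomputable def transducer [Finite T] : IteratedUniformTransducer T where
  State := G.Work ⊕ Bool
  Sym := Option G.Cell
  finite_State := by
    have := G.finite_NT
    have := Fintype.ofFinite T
    have := Fintype.ofFinite G.NT
    have h1 : Finite G.Seen := (List.finite_length_le (Symbol T G.NT) 2).to_subtype
    have h2 : Finite G.Phase := by
      refine Set.Finite.to_subtype
        (s := {p : Option (List (Symbol T G.NT × Option (Symbol T G.NT))) |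
          ∀ P ∈ p, P ∈ G.phases}) (((G.finite_phases.image some).insert none).subset ?_)
      intro p hp
      cases p with
      | none => simp
      | some P => simpa using hp
    infer_instance
  finite_Sym := by
    have := G.finite_NT
    have := Fintype.ofFinite T
    have := Fintype.ofFinite G.NT
    infer_instance
  -- An input letter is itself a cell with digit 0, so the input needs no conversion sweep.
  inp := ⟨fun t => some (some (.terminal t), 0), fun a b h => by simpa using h⟩
  Δ := Set.univ
  sym_mem := fun _ => .inr trivial
  q₀ := .inl G.initWork
  endmarker := none
  endmarker_mem := trivial
  endmarker_notMem := by rintro ⟨t, ht⟩; cases ht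
  acc := {.inr true}
  rej := {.inr false}
  disjoint_acc_rej := by simp
  δ := G.move
  out_mem := fun _ _ _ _ _ => trivial
  δ_total := by
    rintro (s | b) a hq
    · cases a with
      | none => exact ⟨_, .inl rfl⟩
      | some a => exact ⟨_, .inl rfl⟩
    · cases b <;> simp at hq
  endmarker_out := by
    rintro (s | b) (_ | a) p h
    · rfl
    · rcases h with h | ⟨_, _, _, h⟩ <;> cases h
    · exact h.elim
    · exact h.elim

/-- The cells of the initial tape. -/
noncomputable def inputCells (w : List T) : List G.Cell :=
  w.map fun t => (some (.terminal t), 0)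

variable {G}

theorem digitValue_inputCells (w : List T) :
    digitValue ((G.inputCells w).map Prod.snd) = 0 := by
  induction w with
  | nil => rfl
  | cons t w ih =>
    rw [inputCells, List.map_cons, List.map_cons, digitValue, ← inputCells, ih]
    simp

theorem reduceOption_inputCells (w : List T) :
    ((G.inputCells w).map Prod.fst).reduceOption = w.map .terminal := by
  induction w with
  | nil => rfl
  | cons t w ih =>
    rw [inputCells, List.map_cons, List.map_cons, ← inputCells]
    simp [ih]

/-! ### Effect of single sweeps on string and counter. -/

variable [Finite T]

theorem not_run_inr_inl {c : Bool} {u v : List (Option G.Cell)} {s : G.Work}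
    (h : G.transducer.Run (.inr c) u (.inl s) v) : False := by
  cases u with
  | nil => exact Sum.inl_ne_inr h.of_nil.1
  | cons a u =>
    obtain ⟨_, _, _, h, _⟩ := h.exists_of_cons
    exact h.elim

theorem not_run_rej_acc {u v : List (Option G.Cell)}
    (h : G.transducer.Run (.inr false) u (.inr true) v) : False := by
  cases u with
  | nil => exact Bool.noConfusion (Sum.inr.inj h.of_nil.1)
  | cons a u =>
    obtain ⟨_, _, _, h, _⟩ := h.exists_of_cons
    exact h.elim

theorem exists_of_run_cons {q p : G.Work ⊕ Bool} {a : Option G.Cell} {u v : List (Option G.Cell)}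
    (h : G.transducer.Run q (a :: u) p v) :
    ∃ (q' : G.Work ⊕ Bool) (b : Option G.Cell) (v' : List (Option G.Cell)),
      (q', b) ∈ G.move q a ∧ G.transducer.Run q' u p v' ∧ v = b :: v' :=
  h.exists_of_cons

/-- Effect of a run over tape cells between working states. -/
theorem run_cells {u : List G.Cell} {s s' : G.Work} {v : List (Option G.Cell)}
    (h : G.transducer.Run (.inl s) (u.map some) (.inl s') v) :
    ∃ u' : List G.Cell, v = u'.map some ∧
      PatternRun G.patterns s.1.1 (u.map Prod.fst) s'.1.1 (u'.map Prod.fst) ∧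
      digitValue (u'.map Prod.snd) + G.base ^ u.length * s'.2.1.toNat =
        digitValue (u.map Prod.snd) + s.2.1.toNat ∧
      s'.2.2.1 = (s.2.2.1 ++ (u.map Prod.fst).reduceOption).take 2 := by
  induction u generalizing s v with
  | nil =>
    obtain ⟨hs, rfl⟩ := h.of_nil
    obtain rfl := Sum.inl.inj hs
    exact ⟨[], rfl, .nil _, by simp [digitValue], by simp [List.take_of_length_le s'.2.2.2]⟩
  | cons a u ih =>
    obtain ⟨_, _, _, hm, h', rfl⟩ := exists_of_run_cons (u := u.map some) (a := some a) h
    rcases hm with h | ⟨t, b, ⟨h1, h2, h3⟩, h⟩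
    · cases h
      exact (not_run_inr_inl h').elim
    · cases h
      obtain ⟨u', rfl, i1, i2, i3⟩ := ih h'
      refine ⟨b :: u', rfl, .cons h1 i1, ?_, ?_⟩
      · simp only [List.map_cons, digitValue, List.length_cons, pow_succ']
        linear_combination h2 + G.base * i2
      · rw [i3, h3, take_two_append_take_two]
        cases h : a.1 <;> simp [h]

theorem not_run_cells_acc {u : List G.Cell} {s : G.Work} {v : List (Option G.Cell)}
    (h : G.transducer.Run (.inl s) (u.map some) (.inr true) v) : False := by
  induction u generalizing s v with
  | nil => exact Sum.inr_ne_inl h.of_nil.1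
  | cons a u ih =>
    obtain ⟨_, _, _, hm, h', rfl⟩ := exists_of_run_cons (u := u.map some) (a := some a) h
    rcases hm with h | ⟨t, b, _, h⟩
    · cases h
      exact not_run_rej_acc h'
    · cases h
      exact ih h'

/-- Every one-pass reduction is performed by some run, and every run increments the counter. -/
theorem exists_run_cells {u : List G.Cell} {s : G.Work}
    {p : Option (List (Symbol T G.NT × Option (Symbol T G.NT)))}
    {y : List (Option (Symbol T G.NT))}
    (h : PatternRun G.patterns s.1.1 (u.map Prod.fst) p y) :
    ∃ (s' : G.Work) (u' : List G.Cell),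
      G.transducer.Run (.inl s) (u.map some) (.inl s') (u'.map some) ∧
      s'.1.1 = p ∧ u'.map Prod.fst = y := by
  induction u generalizing s y with
  | nil =>
    cases h
    exact ⟨s, [], .nil _, rfl, rfl⟩
  | cons a u ih =>
    cases h with
    | @cons _ p' _ _ b _ v h h' =>
      obtain ⟨d, c, hd⟩ : ∃ (d : Fin G.base) (c : Bool),
          (d : ℕ) + G.base * c.toNat = a.2 + s.2.1.toNat := by
        have h1 := a.2.isLt
        have h2 : s.2.1.toNat ≤ 1 := Bool.toNat_le _
        by_cases hlt : (a.2 : ℕ) + s.2.1.toNat < G.base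
        · exact ⟨⟨_, hlt⟩, false, by simp⟩
        -- A digit below the base plus a carry of at most 1 overflows only by equalling the base,
        -- leaving digit 0.
        · exact ⟨0, true, by simp only [Fin.val_zero, Bool.toNat_true]; omega⟩
      obtain ⟨s', u', i1, i2, i3⟩ := ih (s := (⟨p', G.mem_phases_of_step h s.1.2⟩, c,
        ⟨(s.2.2.1 ++ a.1.toList).take 2, by simp⟩)) h'
      exact ⟨s', (b, d) :: u', .cons (.inr ⟨_, (b, d), ⟨h, hd, rfl⟩, rfl⟩) i1, i2,
        by simp [i3]⟩

/-- The counter is incremented, and at most one rule application is undone, in a sweep that does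
not halt. -/
theorem sweep_cells {u : List G.Cell} {v : List (Option G.Cell)}
    (h : G.transducer.Sweep (u.map some ++ [none]) v) :
    ∃ u' : List G.Cell, v = u'.map some ++ [none] ∧ u'.length = u.length ∧
      digitValue (u'.map Prod.snd) = digitValue (u.map Prod.snd) + 1 ∧
      Relation.ReflTransGen G.ProducesNonerasing (u'.map Prod.fst).reduceOption
        (u.map Prod.fst).reduceOption := by
  obtain ⟨q, h, hq⟩ := h
  obtain ⟨r, v', b, h1, h2, rfl⟩ := h.exists_of_concat
  rcases r with s | c
  · rcases h2 with h2 | ⟨_, h2⟩ | ⟨⟨hp, hc⟩, h2⟩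
    · cases h2
      exact (hq (.inr rfl)).elim
    · cases h2
      exact (hq (.inl rfl)).elim
    · cases h2
      obtain ⟨u', rfl, i1, i2, _⟩ := run_cells h1
      refine ⟨u', rfl, by simpa using i1.length_eq, by simpa [hc, initWork] using i2, ?_⟩
      -- Either no pattern was started and the string is unchanged, or one pattern was completed.
      rcases hp with hp | hp
      · rw [i1.sound_none rfl hp]
      · rw [hp] at i1
        exact .single (producesNonerasing_of_patternRun i1)
  · exact h2.elim

/-- If the counter does not overflow, a one-pass reduction is performed by a sweep. -/
theorem exists_sweep {u : List G.Cell} {y : List (Option (Symbol T G.NT))}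
    (h : PatternRun G.patterns none (u.map Prod.fst) (some []) y)
    (hu : digitValue (u.map Prod.snd) + 1 < G.base ^ u.length) :
    ∃ u' : List G.Cell, G.transducer.Sweep (u.map some ++ [none]) (u'.map some ++ [none]) ∧
      u'.map Prod.fst = y := by
  obtain ⟨s', u', h1, h2, h3⟩ := exists_run_cells (s := G.initWork) h
  refine ⟨u', ⟨.inl G.initWork, h1.append (.cons (.inr (.inr ⟨⟨.inr h2, ?_⟩, rfl⟩)) (.nil _)), ?_⟩,
    h3⟩
  -- A final carry would make the old value plus 1 at least `base ^ u.length`.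
  · obtain ⟨_, _, _, i, _⟩ := run_cells h1
    cases hc : s'.2.1 with
    | false => rfl
    | true =>
      simp only [hc, initWork, Bool.toNat_true] at i
      omega
  · rintro (h | h) <;> exact Sum.inl_ne_inr h

/-- Acceptance happens only at the endmarker, and remembered symbols numbering at most one are the
whole string, since truncation would leave two. -/
theorem haltsIn_acc {u : List G.Cell} {q : G.transducer.State}
    (h : G.transducer.HaltsIn (u.map some ++ [none]) q) (hq : q ∈ G.transducer.acc) :
    G.Derives [.nonterminal G.initial] (u.map Prod.fst).reduceOption := by
  obtain rfl : q = .inr true := hq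
  rcases h with ⟨v, h, _⟩ | ⟨u₁, a, u₂, v, hu, h, _⟩
  · obtain ⟨r, v', b, h1, h2, rfl⟩ := h.exists_of_concat
    rcases r with s | c
    · rcases h2 with h2 | ⟨⟨hl, hd⟩, _⟩ | ⟨_, h2⟩
      · cases h2
      · obtain ⟨_, _, _, _, hs⟩ := run_cells h1
        simp only [initWork, List.nil_append] at hs
        rw [hs] at hl hd
        rwa [List.take_of_length_le] at hd
        simp only [List.length_take] at hl
        omega
      · cases h2
    · exact h2.elim
  · obtain ⟨w, rfl⟩ := exists_map_some_of_concat_eq hu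
    exact (not_run_cells_acc h).elim

/-- A sweep that only waits reaches the endmarker with the string intact; acceptance there ignores
counter overflow. -/
theorem exists_haltsIn_acc {u : List G.Cell} (hl : (u.map Prod.fst).reduceOption.length ≤ 1)
    (hd : G.Derives [.nonterminal G.initial] (u.map Prod.fst).reduceOption) :
    ∃ q ∈ G.transducer.acc, G.transducer.HaltsIn (u.map some ++ [none]) q := by
  have hwait : ∀ x : List (Option (Symbol T G.NT)), PatternRun G.patterns none x none x := by
    intro x
    induction x with
    | nil => exact .nil _
    | cons a x ih => exact .cons (.wait a) ih
  obtain ⟨s', u', h1, _, _⟩ := exists_run_cells (s := G.initWork) (hwait (u.map Prod.fst))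
  obtain ⟨_, _, _, _, hs⟩ := run_cells h1
  simp only [initWork, List.nil_append] at hs
  rw [List.take_of_length_le (by omega)] at hs
  refine ⟨.inr true, rfl, .inl ⟨u'.map some ++ [none],
    h1.append (.cons (.inr (.inl ⟨⟨?_, ?_⟩, rfl⟩)) (.nil _)), .inl rfl⟩⟩
  · rwa [hs]
  · rwa [hs]

theorem start_eq (w : List T) :
    G.transducer.start w = (G.inputCells w).map some ++ [none] := by
  simp only [IteratedUniformTransducer.start, inputCells, List.map_map]
  rfl

/-! ### Termination and the accepted language. -/

theorem transducer_allHalt (w : List T) : G.transducer.AllHalt w := by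
  rintro ⟨f, h0, hf⟩
  have key : ∀ n, ∃ u : List G.Cell, f n = u.map some ++ [none] ∧ u.length = w.length ∧
      digitValue (u.map Prod.snd) = n := by
    intro n
    induction n with
    | zero =>
      exact ⟨G.inputCells w, h0.trans (start_eq w), by simp [inputCells],
        digitValue_inputCells w⟩
    | succ n ih =>
      obtain ⟨u, hu, hl, hv⟩ := ih
      have hs := hf n
      rw [hu] at hs
      obtain ⟨u', h1, h2, h3, _⟩ := sweep_cells hs
      exact ⟨u', h1, h2.trans hl, by rw [h3, hv]⟩
  -- After `n` sweeps the counter shows `n`, but `|w|` digits cannot show `base ^ |w|`.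
  obtain ⟨u, _, hl, hv⟩ := key (G.base ^ w.length)
  have := digitValue_lt (u.map Prod.snd)
  rw [hv, List.length_map, hl] at this
  exact this.false

theorem mem_language_of_someAccepting {w : List T} (h : G.transducer.SomeAccepting w) :
    w ∈ G.language := by
  obtain ⟨v, q, hr, hh, hq⟩ := h
  have key : ∃ u : List G.Cell, v = u.map some ++ [none] ∧
      G.Derives (u.map Prod.fst).reduceOption (w.map .terminal) := by
    clear hh
    induction hr with
    | refl =>
      refine ⟨G.inputCells w, start_eq w, ?_⟩
      rw [reduceOption_inputCells]
      exact .refl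
    | tail _ hs ih =>
      obtain ⟨u, rfl, hd⟩ := ih
      obtain ⟨u', rfl, _, _, hp⟩ := sweep_cells hs
      have hp' : G.Derives (u'.map Prod.fst).reduceOption (u.map Prod.fst).reduceOption :=
        Relation.ReflTransGen.mono (fun _ _ h => ProducesNonerasing.produces h) _ _ hp
      exact ⟨u', rfl, Relation.ReflTransGen.trans hp' hd⟩
  obtain ⟨u, rfl, hd⟩ := key
  exact (haltsIn_acc hh hq).trans hd

theorem someAccepting_of_mem_language {w : List T} (h : w ∈ G.language) :
    G.transducer.SomeAccepting w := by
  have hd : G.Derives [.nonterminal G.initial] ((G.inputCells w).map Prod.fst).reduceOption := by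
    rw [reduceOption_inputCells]
    exact h
  by_cases hw : w = []
  · subst hw
    obtain ⟨q, hq, hh⟩ := exists_haltsIn_acc (u := G.inputCells []) (by simp [inputCells]) hd
    exact ⟨_, q, .refl, start_eq (G := G) [] ▸ hh, hq⟩
  · obtain ⟨m, hm, f, h0, h1, hf⟩ := exists_patternRuns hd
      (by rw [reduceOption_inputCells]; simpa using hw)
    have hlen : (G.inputCells w).length = w.length := by simp [inputCells]
    rw [List.length_map, hlen] at hm
    have hm' : m < G.base ^ w.length := hm.trans_le (Nat.pow_le_pow_left (Nat.le_succ _) _)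
    have key : ∀ i ≤ m, ∃ u : List G.Cell,
        Relation.ReflTransGen G.transducer.Sweep (G.transducer.start w) (u.map some ++ [none]) ∧
        u.length = w.length ∧ digitValue (u.map Prod.snd) = i ∧ u.map Prod.fst = f i := by
      intro i hi
      induction i with
      | zero =>
        refine ⟨G.inputCells w, ?_, hlen, digitValue_inputCells w, h0.symm⟩
        rw [start_eq]
      | succ i ih =>
        obtain ⟨u, hr, hl, hv, hfu⟩ := ih (by omega)
        obtain ⟨u', hs, hy⟩ := exists_sweep (u := u) (hfu ▸ hf i hi) (by rw [hv, hl]; omega)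
        obtain ⟨u'', he, hl', hv', _⟩ := sweep_cells hs
        -- `exists_sweep` controls the string and `sweep_cells` the counter; both describe the same
        -- output tape.
        obtain rfl : u' = u'' := map_some_concat_injective he
        exact ⟨u', hr.tail hs, hl'.trans hl, by rw [hv', hv], hy⟩
    obtain ⟨u, hr, _, _, hfu⟩ := key m le_rfl
    have hS : (u.map Prod.fst).reduceOption = [.nonterminal G.initial] := by rw [hfu, h1]
    obtain ⟨q, hq, hh⟩ := exists_haltsIn_acc (u := u) (by simp [hS]) (by rw [hS]; exact .refl)
    exact ⟨_, q, hr, hh, hq⟩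

end Transducer

end ContextSensitiveGrammar

theorem mainTheorem10 {T : Type u} [Finite T] (L : Language T) (hL : L.IsContextSensitive) :
    ∃ M : IteratedUniformTransducer T, M.language = L ∧ ∀ w : List T, w ∉ L → M.Rejects w := by
  obtain ⟨G, rfl⟩ := hL
  open ContextSensitiveGrammar in
  exact ⟨G.transducer,
    Set.ext fun w => ⟨fun h => mem_language_of_someAccepting h.2,
      fun h => ⟨transducer_allHalt w, someAccepting_of_mem_language h⟩⟩,
    fun w hw => ⟨transducer_allHalt w, fun h => hw (mem_language_of_someAccepting h)⟩⟩
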